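/- Work with germs at the origin of $\mathbb{R}^2$ of $C^\infty$ objects, and let $\mathcal{E}$ be the ring of germs of smooth functions. Let $a_L = x\,dy$ and $X_{a_L} = -x\,\frac{\partial}{\partial x}$, and let $\ker(a_L) = \{ f\cdot X_{a_L} : f\in\mathcal{E}\}$ be the $\mathcal{E}$-module generated by $X_{a_L}$; the map $f\mapsto f\cdot X_{a_L}$ is a linear isomorphism $\mathcal{E}\to\ker(a_L)$. Two fields $X_1,X_2\in\ker(a_L)$ are called orbitally $a_L$-conjugate if there are a diffeomorphism germ $\phi:(\mathbb{R}^2,0)\to(\mathbb{R}^2,0)$ and germs $k,h\in\mathcal{E}$, not vanishing at the origin, with $a_L = k\cdot\phi^*a_L$ and $X_1 = h\cdot\phi^*X_2$. The tangent space at $X=f\cdot X_{a_L}$ of its conjugacy class is $\{g\cdot X_{a_L} : g\in\langle f,\mathcal{L}_{X_{a_L}}f\rangle\}$, and the codimension of $X$ is $\dim_{\mathbb{R}}\mathcal{E}/\langle f,\mathcal{L}_{X_{a_L}}f\rangle$. A conjugacy class has codimension $k$ in $\ker(a_L)$ if each of its members has codimension $k$. Let $S\subset\ker(a_L)$ be the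 set of fields $f\cdot X_{a_L}$ whose curve of fixed points $\{f=0\}$ passes through the origin, is regular there ($d_0f\neq 0$), and is transversal there to both coordinate axes. Then: 1. $S$ is an orbital $a_L$-conjugacy class, and it has codimension $1$ in $\ker(a_L)$. 2. Every member of $S$ is orbitally $a_L$-conjugate to $(x+y)\cdot X_{a_L}$, and $S$ is exactly the conjugacy class of this field. 3. The family $(c+x+y)\cdot X_{a_L}$, $c\in\mathbb{R}$, of fields in $\ker(a_L)$ intersects this class transversely at $c=0$: its member at $c=0$ lies in the class, and the velocity of the family at $c=0$, together with the tangent space of the class at that member, spans $\ker(a_L)$. -/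

import Mathlib

open Filter Topology
open scoped ContDiff

noncomputable section

namespace LiouvilleKernel

/-- The plane, with coordinates `x = p.1` and `y = p.2`. -/
abbrev Plane : Type := ℝ × ℝ

/-- Germs at the origin of the plane. -/
abbrev G (F : Type) : Type := Germ (𝓝 (0 : Plane)) F

section Smooth

variable {F : Type} [NormedAddCommGroup F] [NormedSpace ℝ F]

/-- `f` is `C^∞` on a neighbourhood of the origin. -/
def SmoothNear (f : Plane → F) : Prop := ∀ᶠ p in 𝓝 (0 : Plane), ContDiffAt ℝ ∞ f p

/-- A germ at the origin is smooth if it has a smooth representative. -/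
def IsSmooth (g : G F) : Prop := ∃ f : Plane → F, SmoothNear f ∧ g = (f : G F)

/-- The differential of a germ, as a germ of maps into linear maps. -/
def dGerm (g : G F) : G (Plane →L[ℝ] F) :=
  Quotient.map' (fun f => fderiv ℝ f) (fun _ _ h => EventuallyEq.fderiv h) g

theorem dGerm_coe (f : Plane → F) : dGerm (f : G F) = (fderiv ℝ f : G (Plane →L[ℝ] F)) := rfl

theorem SmoothNear.fderiv {f : Plane → F} (hf : SmoothNear f) : SmoothNear (fderiv ℝ f) :=
  Eventually.mono hf fun _ hp => hp.fderiv_right (by simp)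

end Smooth

/-- The ring `ℰ` of germs at the origin of smooth real functions. -/
def smoothGerms : Subring (G ℝ) where
  carrier := {g | IsSmooth g}
  mul_mem' := by
    rintro _ _ ⟨f, hf, rfl⟩ ⟨g, hg, rfl⟩
    exact ⟨f * g, by filter_upwards [hf, hg] with p h1 h2 using h1.mul h2, rfl⟩
  one_mem' := ⟨1, Eventually.of_forall fun _ => contDiffAt_const, rfl⟩
  add_mem' := by
    rintro _ _ ⟨f, hf, rfl⟩ ⟨g, hg, rfl⟩
    exact ⟨f + g, by filter_upwards [hf, hg] with p h1 h2 using h1.add h2, rfl⟩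
  zero_mem' := ⟨0, Eventually.of_forall fun _ => contDiffAt_const, rfl⟩
  neg_mem' := by
    rintro _ ⟨f, hf, rfl⟩
    exact ⟨-f, by filter_upwards [hf] with p h1 using h1.neg, rfl⟩

/-- Smooth function germs, as a type. -/
abbrev E : Type := smoothGerms

/-- Real constants as smooth germs. -/
def constGerm : ℝ →+* E where
  toFun c := ⟨((fun _ => c : Plane → ℝ) : G ℝ), _, Eventually.of_forall fun _ => contDiffAt_const, rfl⟩
  map_one' := rfl
  map_mul' _ _ := rfl
  map_zero' := rfl
  map_add' _ _ := rfl

instance : Algebra ℝ E := constGerm.toAlgebra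

instance (F : Type) [NormedAddCommGroup F] [NormedSpace ℝ F] : IsScalarTower ℝ E (G F) where
  smul_assoc c f X := by
    obtain ⟨f, hf⟩ := f
    have h : (c • (⟨f, hf⟩ : E)) • X = (((fun _ => c : Plane → ℝ) : G ℝ) * f) • X := rfl
    rw [h]
    induction f using Germ.inductionOn with | _ f
    induction X using Germ.inductionOn with | _ X
    exact congrArg (fun u : Plane → F => (u : G F)) (funext fun p => mul_smul c (f p) (X p))

/-- A germ of a diffeomorphism `(ℝ², 0) → (ℝ², 0)`, given by a representative and a representative
of the inverse germ. -/
structure LocalDiffeo where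
  toFun : Plane → Plane
  invFun : Plane → Plane
  map_zero : toFun 0 = 0
  smooth : SmoothNear toFun
  smooth_inv : SmoothNear invFun
  left_inv : ∀ᶠ p in 𝓝 (0 : Plane), invFun (toFun p) = p
  right_inv : ∀ᶠ p in 𝓝 (0 : Plane), toFun (invFun p) = p

namespace LocalDiffeo

theorem tendsto (φ : LocalDiffeo) : Tendsto φ.toFun (𝓝 0) (𝓝 0) := by
  simpa [ContinuousAt, φ.map_zero] using φ.smooth.self_of_nhds.continuousAt

/-- The pull-back `φ^* b` of a germ of a 1-form: `(φ^* b)_p = b_{φ(p)} ∘ d_p φ`. -/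
def pullbackForm (φ : LocalDiffeo) (b : G (Plane →L[ℝ] ℝ)) : G (Plane →L[ℝ] ℝ) :=
  Germ.map₂ (fun β L => β.comp L) (b.compTendsto φ.toFun φ.tendsto)
    (fderiv ℝ φ.toFun : G (Plane →L[ℝ] Plane))

/-- The pull-back `φ^* X` of a germ of a vector field: `(φ^* X)_p = (d_p φ)⁻¹ (X_{φ(p)})`. The
differential is invertible at all points near the origin. -/
def pullbackField (φ : LocalDiffeo) (X : G Plane) : G Plane :=
  Germ.map₂ (fun v L => ContinuousLinearMap.inverse L v) (X.compTendsto φ.toFun φ.tendsto)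
    (fderiv ℝ φ.toFun : G (Plane →L[ℝ] Plane))

end LocalDiffeo

/-- A function germ is non-zero if it does not vanish at (hence near) the origin. -/
def NonZero (k : E) : Prop := (k : G ℝ).value ≠ 0

/-- Orbital `a`-conjugacy: there is a conformal symmetry `φ` of `a` (`a = k · φ^* a` with `k`
non-zero) and a non-zero function `h` with `X₁ = h · φ^* X₂`. -/
def OrbitallyConj (a : G (Plane →L[ℝ] ℝ)) (X₁ X₂ : G Plane) : Prop :=
  ∃ (φ : LocalDiffeo) (k h : E), NonZero k ∧ NonZero h ∧
    a = k • φ.pullbackForm a ∧ X₁ = h • φ.pullbackField X₂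

/-- The volume form `ω = dy ∧ dx`. -/
def volumeForm (u v : Plane) : ℝ := u.2 * v.1 - u.1 * v.2

/-- The vector dual to a covector with respect to `ω`. -/
def dualVector (α : Plane →L[ℝ] ℝ) : Plane := (-α (0, 1), α (1, 0))

/-- `dualVector α` is the unique vector `u` with `u ⌟ ω = α`. -/
theorem volumeForm_eq_iff (α : Plane →L[ℝ] ℝ) (u : Plane) :
    (∀ v, volumeForm u v = α v) ↔ u = dualVector α := by
  constructor
  · intro h
    have h1 := h (0, 1)
    have h2 := h (1, 0)
    simp only [volumeForm] at h1 h2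
    ext <;> simp only [dualVector] <;> linarith
  · rintro rfl ⟨s, t⟩
    have : ((s, t) : Plane) = s • ((1, 0) : Plane) + t • ((0, 1) : Plane) := by simp
    rw [this, map_add, map_smul, map_smul]
    simp [volumeForm, dualVector]
    ring

/-- The vector field `X_a` of a 1-form `a`, defined by `X_a ⌟ ω = a`. -/
def fieldOf (a : G (Plane →L[ℝ] ℝ)) : G Plane := a.map dualVector

/-- The Lie derivative of a function germ along a vector field germ. -/
def lieDeriv (X : G Plane) (f : G ℝ) : G ℝ := Germ.map₂ (fun L v => L v) (dGerm f) X

theorem lieDeriv_smooth {X : G Plane} (hX : IsSmooth X) (f : E) :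
    lieDeriv X (f : G ℝ) ∈ smoothGerms := by
  obtain ⟨_, f, hf, rfl⟩ := f
  obtain ⟨X, hX, rfl⟩ := hX
  exact ⟨fun p => fderiv ℝ f p (X p), by
    filter_upwards [hf.fderiv, hX] with p h1 h2 using h1.clm_apply h2, rfl⟩

/-- The Liouville form `a_L = x dy`. -/
def aL : G (Plane →L[ℝ] ℝ) :=
  ((fun p => p.1 • ContinuousLinearMap.snd ℝ ℝ ℝ : Plane → Plane →L[ℝ] ℝ) : G (Plane →L[ℝ] ℝ))

/-- The vector field `X_{a_L}`. -/
def XL : G Plane := fieldOf aL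

/-- `X_{a_L} = - x ∂/∂x`. -/
theorem XL_eq : XL = ((fun p => (-p.1, 0) : Plane → Plane) : G Plane) :=
  congrArg (fun u : Plane → Plane => (u : G Plane)) (funext fun p => by simp [dualVector])

theorem XL_smooth : IsSmooth XL :=
  ⟨_, Eventually.of_forall fun _ => by fun_prop, XL_eq⟩

/-- `ker(a_L)`: the `ℰ`-module of vector field germs `f · X_{a_L}` with `f ∈ ℰ`. -/
def kerL : Submodule E (G Plane) := LinearMap.range (LinearMap.toSpanSingleton E (G Plane) XL)

/-- The members of `ker(a_L)` are smooth. -/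
theorem kerL_smooth (X : kerL) : IsSmooth (X : G Plane) := by
  obtain ⟨_, ⟨_, f, hf, rfl⟩, rfl⟩ := X
  obtain ⟨V, hV, h⟩ := XL_smooth
  refine ⟨fun p => f p • V p, by filter_upwards [hf, hV] with p h1 h2 using h1.smul h2, ?_⟩
  simp only [LinearMap.toSpanSingleton_apply, h]
  rfl

/-- The members of `ker(a_L)` are annihilated by `a_L`. -/
theorem kerL_annihilated (X : kerL) :
    Germ.map₂ (fun (α : Plane →L[ℝ] ℝ) v => α v) aL (X : G Plane) = 0 := by
  obtain ⟨_, ⟨_, f, hf, rfl⟩, rfl⟩ := X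
  simp only [LinearMap.toSpanSingleton_apply, XL_eq]
  exact congrArg (fun u : Plane → ℝ => (u : G ℝ)) (funext fun p => by simp)

theorem smul_XL_injective : Function.Injective (LinearMap.toSpanSingleton E (G Plane) XL) := by
  rw [injective_iff_map_eq_zero]
  rintro ⟨_, f, hf, rfl⟩ h
  have h' : ∀ᶠ p in 𝓝 (0 : Plane), f p * p.1 = 0 := by
    simp only [LinearMap.toSpanSingleton_apply, XL_eq] at h
    have h2 : ((fun p => f p • ((-p.1, 0) : Plane) : Plane → Plane) : G Plane)
        = ((fun _ => 0 : Plane → Plane) : G Plane) := h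
    filter_upwards [Germ.coe_eq.1 h2] with p hp
    have := congrArg Prod.fst hp
    simpa using this
  apply Subtype.ext
  refine Germ.coe_eq.2 ?_
  filter_upwards [hf, h'.eventually_nhds] with p h1 h2
  by_contra hne
  have h3 : ∀ᶠ q in 𝓝 p, q.1 = 0 := by
    filter_upwards [h1.continuousAt.eventually_ne hne, h2] with q hq1 hq2
    exact (mul_eq_zero.1 hq2).resolve_left hq1
  have h4 : Tendsto (fun t : ℝ => ((p.1 + t, p.2) : Plane)) (𝓝 0) (𝓝 p) := by
    have : Continuous (fun t : ℝ => ((p.1 + t, p.2) : Plane)) := by fun_prop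
    simpa using this.tendsto 0
  have h5 : ∀ᶠ t : ℝ in 𝓝[≠] 0, p.1 + t = 0 := (h4.eventually h3).filter_mono nhdsWithin_le_nhds
  have h6 := h3.self_of_nhds
  obtain ⟨t, ht, ht'⟩ := (h5.and self_mem_nhdsWithin).exists
  rw [h6, zero_add] at ht
  exact ht' ht

/-- The linear isomorphism `f ↦ f · X_{a_L}` of `ℰ` onto `ker(a_L)`. -/
def toField : E ≃ₗ[E] kerL := LinearEquiv.ofInjective _ smul_XL_injective

theorem toField_coe (f : E) : (toField f : G Plane) = f • XL := rfl

/-- The ideal `⟨f, L_{X_{a_L}} f⟩` of `ℰ`: the tangent space at `f` of the equivalence class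
of `f`. -/
def tangentIdeal (f : E) : Ideal E := Ideal.span {f, ⟨lieDeriv XL f, lieDeriv_smooth XL_smooth f⟩}

/-- The codimension of `X = f · X_{a_L}` with respect to orbital `a_L`-conjugacy, i.e. the real
dimension of `ℰ / ⟨f, L_{X_{a_L}} f⟩`. -/
def codim (X : kerL) : Cardinal := Module.rank ℝ (E ⧸ tangentIdeal (toField.symm X))

/-- The tangent space at `X = f · X_{a_L}` of the equivalence class of `X`: all `g · X_{a_L}` with
`g ∈ ⟨f, L_{X_{a_L}} f⟩`. -/
def tangentSpace (X : kerL) : Submodule ℝ kerL :=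
  (Submodule.map toField.toLinearMap (tangentIdeal (toField.symm X))).restrictScalars ℝ

/-- The orbital `a_L`-conjugacy class of `X₀` in `ker(a_L)`. -/
def conjClass (X₀ : kerL) : Set kerL := {X | OrbitallyConj aL (X : G Plane) (X₀ : G Plane)}

/-- `S` is an orbital `a_L`-conjugacy class, of codimension `k` in `ker(a_L)` at each of its
points. -/
def HasCodimension (S : Set kerL) (k : ℕ) : Prop :=
  (∃ X₀ : kerL, S = conjClass X₀) ∧ ∀ X ∈ S, codim X = k

/-- The line `y = 0`. -/
def xAxis : Submodule ℝ Plane := Submodule.span ℝ {(1, 0)}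

/-- The line `x = 0`. -/
def yAxis : Submodule ℝ Plane := Submodule.span ℝ {(0, 1)}

/-- The differential `d_0 f` at the origin. -/
def d0 (f : E) : Plane →L[ℝ] ℝ := (dGerm (f : G ℝ)).value

/-- `{f = 0}` is a curve through the origin, regular there (`d_0 f ≠ 0`), whose tangent line
`ker d_0 f` is transversal to both coordinate axes. -/
def RegularTransversalCurve (f : E) : Prop :=
  (f : G ℝ).value = 0 ∧ d0 f ≠ 0 ∧
    LinearMap.ker (d0 f).toLinearMap ⊔ xAxis = ⊤ ∧ LinearMap.ker (d0 f).toLinearMap ⊔ yAxis = ⊤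

/-- The fields `f · X_{a_L}` whose curve of fixed points `{f = 0}` is regular at the origin and
transversal to both coordinate axes. -/
def transversalFields : Set kerL := {X | RegularTransversalCurve (toField.symm X)}

/-- The germ of the function `x + y`. -/
def xPlusY : E :=
  ⟨((fun p => p.1 + p.2 : Plane → ℝ) : G ℝ), _,
    Eventually.of_forall fun _ => by fun_prop, rfl⟩

/-- The one-parameter family `V c` of vector fields in `ker(a_L)`, smooth near `(c₀, 0)`,
intersects the class of `X₀` transversely at `c = c₀`: `V c₀` lies in the class, and the velocity
of the family at `c₀` together with the tangent space of the class at `V c₀` spans `ker(a_L)`. -/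
def IntersectsTransversely (V : ℝ → Plane → Plane) (c₀ : ℝ) (X₀ : kerL) : Prop :=
  (∀ᶠ q in 𝓝 (c₀, (0 : Plane)), ContDiffAt ℝ ∞ (fun r : ℝ × Plane => V r.1 r.2) q) ∧
  (∀ c, (V c : G Plane) ∈ kerL) ∧
  ∃ Y W : kerL, (Y : G Plane) = (V c₀ : G Plane) ∧
    (W : G Plane) = ((fun p => deriv (fun c => V c p) c₀ : Plane → Plane) : G Plane) ∧
    Y ∈ conjClass X₀ ∧ tangentSpace Y ⊔ Submodule.span ℝ {W} = ⊤

/-- The family `(c + x + y) · X_{a_L}`, with `X_{a_L} = - x ∂/∂x`. -/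
def family (c : ℝ) (p : Plane) : Plane := (c + p.1 + p.2) • ((-p.1, 0) : Plane)

end LiouvilleKernel

end

namespace LiouvilleKernel

/-! Normal form: Hadamard's lemma gives `f(x, y) = f(0, y) + x u(x, y)` with `u(0) = ∂ₓf(0)`. When
both partial derivatives of `f` are nonzero at `0`, `φ = (x u, f(0, y))` is a local diffeomorphism.
Its second component depends on `y` alone and its first is divisible by `x`, so `φ` preserves `x dy`
up to a nonzero factor; its components add up to `f`, so it pulls `(x + y) · X_L` back to a nonzero
multiple of `f · X_L`.

Conversely, a symmetry `ψ` with `x dy = K · ψ^*(x dy)` satisfies `∂ₓψ₂ = 0`, `x = K ψ₁ ∂ᵧψ₂`, and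
has a diagonal invertible differential at `0`. Conjugacy of `f · X_L` to `(x + y) · X_L` then makes
`f` a nonzero multiple of `ψ₁ + ψ₂`, so `f(0) = 0` and both partial derivatives of `f` are nonzero
at `0`.

Codimension and transversality: `L_{X_L} f = -x ∂ₓf` with `∂ₓf` a unit, so `⟨f, L_{X_L} f⟩` contains
`x`, hence `y`, and is the maximal ideal. The constants complement it, and the family moves in their
direction. -/

/-! ### Hadamard's lemma and the inverse function theorem. -/

/-- Parametric integrals of smooth functions over `[0, 1]` are smooth. -/
theorem contDiff_parametric_integral {P : Type} [NormedAddCommGroup P] [NormedSpace ℝ P]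
    [ProperSpace P] (n : ℕ) : ∀ {F : Type} [NormedAddCommGroup F] [NormedSpace ℝ F]
    {H : P × ℝ → F}, ContDiff ℝ ∞ H → ContDiff ℝ n (fun p => ∫ t in (0 : ℝ)..1, H (p, t)) := by
  -- The target space varies in the induction: the derivative takes values in `P →L[ℝ] F`.
  induction n with
  | zero =>
    intro F _ _ H hH
    refine contDiff_zero.2 ?_
    exact intervalIntegral.continuous_parametric_intervalIntegral_of_continuous'
      (f := fun p t => H (p, t)) hH.continuous 0 1
  | succ n ih =>
    intro F _ _ H hH
    set H' : P × ℝ → P →L[ℝ] F :=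
      fun q => (fderiv ℝ H q).comp (ContinuousLinearMap.inl ℝ P ℝ) with hH'
    have hs : ContDiff ℝ ∞ H' :=
      (hH.fderiv_right (m := ∞) (by simp)).clm_comp contDiff_const
    refine contDiff_succ_iff_hasFDerivAt.2 ⟨_, ih hs, fun p => ?_⟩
    -- Compactness of ball times interval gives the constant that dominates the derivative.
    have hK : IsCompact (Metric.closedBall p 1 ×ˢ Set.uIcc (0 : ℝ) 1) :=
      (isCompact_closedBall p 1).prod isCompact_uIcc
    obtain ⟨C, hC⟩ := hK.exists_bound_of_continuousOn hs.continuous.continuousOn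
    have hc : ∀ q, Continuous fun t : ℝ => H (q, t) := fun q => by
      have := hH.continuous; fun_prop
    have hc' : ∀ q, Continuous fun t : ℝ => H' (q, t) := fun q => by
      have := hs.continuous; fun_prop
    refine intervalIntegral.hasFDerivAt_integral_of_dominated_of_fderiv_le
      (bound := fun _ => C) (F' := fun p t => H' (p, t)) (Metric.ball_mem_nhds p one_pos)
      (Eventually.of_forall fun q => (hc q).aestronglyMeasurable)
      ((hc p).intervalIntegrable 0 1) (hc' p).aestronglyMeasurable ?_
      intervalIntegrable_const ?_
    · exact Eventually.of_forall fun t ht q hq =>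
        hC (q, t) ⟨Metric.ball_subset_closedBall hq, Set.uIoc_subset_uIcc ht⟩
    · refine Eventually.of_forall fun t ht q hq => ?_
      have h1 : HasFDerivAt H (fderiv ℝ H (q, t)) (q, t) :=
        (hH.differentiable (by simp) _).hasFDerivAt
      exact h1.comp q (hasFDerivAt_prodMk_left q t)

/-- Hadamard's lemma in the first variable. -/
theorem exists_hadamard_fst {f : Plane → ℝ} (hf : ContDiff ℝ ∞ f) :
    ∃ u : Plane → ℝ, ContDiff ℝ ∞ u ∧ (∀ p, f p = f (0, p.2) + p.1 * u p) ∧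
      u 0 = fderiv ℝ f 0 (1, 0) := by
  have hf' : ContDiff ℝ ∞ (fderiv ℝ f) := hf.fderiv_right (by simp)
  have hm : ContDiff ℝ ∞ (fun q : Plane × ℝ => ((q.2 * q.1.1, q.1.2) : Plane)) := by fun_prop
  have hH : ContDiff ℝ ∞ (fun q : Plane × ℝ =>
      fderiv ℝ f ((q.2 * q.1.1, q.1.2) : Plane) (1, 0)) :=
    (hf'.comp hm).clm_apply contDiff_const
  -- `u` averages `∂ₓf` over the horizontal segment from `(0, y)` to `(x, y)`.
  refine ⟨fun p => ∫ t in (0 : ℝ)..1, fderiv ℝ f (t * p.1, p.2) (1, 0),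
    contDiff_infty.2 fun n => contDiff_parametric_integral n hH, fun p => ?_,
    by simp [Prod.mk_zero_zero]⟩
  have hd : ∀ t ∈ Set.uIcc (0 : ℝ) 1, HasDerivAt (fun t : ℝ => f (t * p.1, p.2))
      (p.1 * fderiv ℝ f (t * p.1, p.2) (1, 0)) t := by
    intro t _
    have h1 : HasDerivAt (fun t : ℝ => ((t * p.1, p.2) : Plane)) (p.1, 0) t := by
      simpa using ((hasDerivAt_id t).mul_const p.1).prodMk (hasDerivAt_const t p.2)
    have h2 := (hf.differentiable (by simp) (t * p.1, p.2)).hasFDerivAt.comp_hasDerivAt t h1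
    have h3 : ((p.1, 0) : Plane) = p.1 • ((1, 0) : Plane) := by simp
    rwa [h3, map_smul, smul_eq_mul] at h2
  have hc : Continuous fun t : ℝ => p.1 * fderiv ℝ f (t * p.1, p.2) (1, 0) := by
    have := hH.continuous.comp (Continuous.prodMk_right p)
    exact continuous_const.mul this
  have := intervalIntegral.integral_eq_sub_of_hasDerivAt hd (hc.intervalIntegrable 0 1)
  rw [intervalIntegral.integral_const_mul] at this
  simp only [one_mul, zero_mul, Prod.mk.eta] at this
  linarith

/-- A smooth germ has a globally smooth representative. -/
theorem SmoothNear.exists_contDiff {f : Plane → ℝ} (hf : SmoothNear f) :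
    ∃ g : Plane → ℝ, ContDiff ℝ ∞ g ∧ f =ᶠ[𝓝 0] g := by
  obtain ⟨r, hr, h⟩ := Metric.eventually_nhds_iff_ball.1 hf
  let χ : ContDiffBump (0 : Plane) := ⟨r / 4, r / 2, by linarith, by linarith⟩
  refine ⟨fun p => χ p * f p, contDiff_iff_contDiffAt.2 fun p => ?_, ?_⟩
  · by_cases hp : p ∈ tsupport χ
    · rw [χ.tsupport_eq] at hp
      exact χ.contDiffAt.mul (h p (Metric.closedBall_subset_ball (by simp [χ]; linarith) hp))
    · have h0 : (fun q => χ q * f q) =ᶠ[𝓝 p] fun _ => 0 := by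
        filter_upwards [notMem_tsupport_iff_eventuallyEq.1 hp] with q hq
        simp [hq]
      exact contDiffAt_const.congr_of_eventuallyEq h0
  · filter_upwards [χ.eventuallyEq_one] with p hp
    simp [hp]

/-- The inverse function theorem for germs. -/
theorem exists_localDiffeo {f : Plane → Plane} (hf : SmoothNear f) (h0 : f 0 = 0)
    (hi : (fderiv ℝ f 0).IsInvertible) : ∃ φ : LocalDiffeo, φ.toFun = f := by
  obtain ⟨e', he'⟩ := hi
  have hd : ∀ {p}, ContDiffAt ℝ ∞ f p → HasFDerivAt f (fderiv ℝ f p) p :=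
    fun h => (h.differentiableAt (by simp)).hasFDerivAt
  have hf0 := hf.self_of_nhds
  have hd0 : HasFDerivAt f (e' : Plane →L[ℝ] Plane) 0 := by rw [he']; exact hd hf0
  let e := hf0.toOpenPartialHomeomorph f hd0 (by simp)
  have hcoe : (e : Plane → Plane) = f := hf0.toOpenPartialHomeomorph_coe hd0 (by simp)
  have hs : (0 : Plane) ∈ e.source := hf0.mem_toOpenPartialHomeomorph_source hd0 (by simp)
  have ht : (0 : Plane) ∈ e.target := by
    have := hf0.image_mem_toOpenPartialHomeomorph_target hd0 (by simp)
    rwa [h0] at this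
  have hsymm : e.symm 0 = 0 := by
    have := e.left_inv hs
    rwa [hcoe, h0] at this
  -- Smoothness of the inverse is needed at all nearby points; invertible maps form an open set.
  have hinv : ∀ᶠ p in 𝓝 (0 : Plane), (fderiv ℝ f p).IsInvertible := by
    have hc : ContinuousAt (fderiv ℝ f) 0 := hf.fderiv.self_of_nhds.continuousAt
    have := ContinuousLinearEquiv.nhds e'
    rw [he'] at this
    exact hc this
  have hcs : Tendsto e.symm (𝓝 0) (𝓝 0) := by
    have := e.continuousAt_symm ht
    rwa [ContinuousAt, hsymm] at this
  refine ⟨⟨f, e.symm, h0, hf, ?_, ?_, ?_⟩, rfl⟩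
  · filter_upwards [e.open_target.mem_nhds ht, hcs.eventually hinv, hcs.eventually hf]
      with q hq ⟨e₁, h1⟩ h2
    refine e.contDiffAt_symm (f₀' := e₁) hq ?_ ?_
    · rw [hcoe, h1]; exact hd h2
    · rw [hcoe]; exact h2
  · filter_upwards [e.open_source.mem_nhds hs] with p hp
    have := e.left_inv hp
    rwa [hcoe] at this
  · filter_upwards [e.open_target.mem_nhds ht] with p hp
    have := e.right_inv hp
    rwa [hcoe] at this

/-! ### Triangular endomorphisms of the plane. -/

/-- An endomorphism of the plane with matrix `(a, *; 0, d)`, `a d ≠ 0`, is invertible. -/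
theorem isInvertible_of_triangular {L : Plane →L[ℝ] Plane} (h0 : (L (1, 0)).2 = 0)
    (ha : (L (1, 0)).1 ≠ 0) (hd : (L (0, 1)).2 ≠ 0) : L.IsInvertible := by
  have hL : ∀ v : Plane, L v = v.1 • L (1, 0) + v.2 • L (0, 1) := fun v => by
    rw [← map_smul, ← map_smul, ← map_add]; simp
  have hinj : Function.Injective L := by
    refine (injective_iff_map_eq_zero L).2 fun v hv => ?_
    rw [hL] at hv
    have h2 := congrArg Prod.snd hv
    simp only [Prod.snd_add, Prod.smul_snd, h0, smul_eq_mul, mul_zero, zero_add, Prod.snd_zero,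
      mul_eq_zero, hd, or_false] at h2
    have h1 := congrArg Prod.fst hv
    simp only [h2, Prod.fst_add, Prod.smul_fst, smul_eq_mul, zero_mul, add_zero, Prod.fst_zero,
      mul_eq_zero, ha, or_false] at h1
    exact Prod.ext h1 h2
  exact ⟨(LinearEquiv.ofInjectiveEndo L.toLinearMap hinj).toContinuousLinearEquiv, by ext <;> rfl⟩

/-- The horizontal line is invariant under `L`. This computes pull-backs of multiples of `∂/∂x`. -/
theorem inverse_apply_of_triangular {L : Plane →L[ℝ] Plane} (h0 : (L (1, 0)).2 = 0)
    (ha : (L (1, 0)).1 ≠ 0) (hd : (L (0, 1)).2 ≠ 0) (c : ℝ) :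
    L.inverse (c, 0) = (c / (L (1, 0)).1, 0) := by
  have h : L ((c / (L (1, 0)).1, 0) : Plane) = (c, 0) := by
    have : ((c / (L (1, 0)).1, 0) : Plane) = (c / (L (1, 0)).1) • ((1, 0) : Plane) := by simp
    rw [this, map_smul]
    ext
    · simp [ha]
    · simp [h0]
  rw [← h, (isInvertible_of_triangular h0 ha hd).inverse_apply_self]

/-! ### The local ring of smooth germs and its maximal ideal. -/

/-- The germ of a function that is smooth near the origin. -/
def SmoothNear.toGerm {f : Plane → ℝ} (hf : SmoothNear f) : E := ⟨(f : G ℝ), f, hf, rfl⟩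

theorem SmoothNear.of_contDiff {F : Type} [NormedAddCommGroup F] [NormedSpace ℝ F]
    {f : Plane → F} (hf : ContDiff ℝ ∞ f) : SmoothNear f :=
  Eventually.of_forall fun _ => hf.contDiffAt

theorem SmoothNear.inv {f : Plane → ℝ} (hf : SmoothNear f) (h0 : f 0 ≠ 0) :
    SmoothNear fun p => (f p)⁻¹ := by
  filter_upwards [hf, hf.self_of_nhds.continuousAt.eventually_ne h0] with p h1 h2
  exact h1.inv h2

theorem SmoothNear.mul {f g : Plane → ℝ} (hf : SmoothNear f) (hg : SmoothNear g) :
    SmoothNear fun p => f p * g p := by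
  filter_upwards [hf, hg] with p h1 h2 using h1.mul h2

theorem exists_contDiff_toGerm (f : E) :
    ∃ (g : Plane → ℝ) (hg : ContDiff ℝ ∞ g), f = (SmoothNear.of_contDiff hg).toGerm := by
  obtain ⟨_, f, hf, rfl⟩ := f
  obtain ⟨g, hg, h⟩ := hf.exists_contDiff
  exact ⟨g, hg, Subtype.ext (Germ.coe_eq.2 h)⟩

/-- Evaluation at the origin. -/
def evalZero : E →ₐ[ℝ] ℝ where
  toFun f := (f : G ℝ).value
  map_one' := rfl
  map_mul' := by
    rintro ⟨_, f, _, rfl⟩ ⟨_, g, _, rfl⟩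
    rfl
  map_zero' := rfl
  map_add' := by
    rintro ⟨_, f, _, rfl⟩ ⟨_, g, _, rfl⟩
    rfl
  commutes' _ := rfl

theorem isUnit_of_evalZero_ne {f : E} (h : evalZero f ≠ 0) : IsUnit f := by
  obtain ⟨_, f, hf, rfl⟩ := f
  have h0 : f 0 ≠ 0 := h
  refine IsUnit.of_mul_eq_one (hf.inv h0).toGerm (Subtype.ext (Germ.coe_eq.2 ?_))
  filter_upwards [hf.self_of_nhds.continuousAt.eventually_ne h0] with p hp
  exact mul_inv_cancel₀ hp

/-- The germ of the coordinate `x`. -/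
def coordX : E := (SmoothNear.of_contDiff (contDiff_fst (𝕜 := ℝ) (E := ℝ) (F := ℝ))).toGerm

/-- The germ of the coordinate `y`. -/
def coordY : E := (SmoothNear.of_contDiff (contDiff_snd (𝕜 := ℝ) (E := ℝ) (F := ℝ))).toGerm

/-- Hadamard's lemma for germs. -/
theorem exists_hadamard (f : E) : ∃ u v : E, f = constGerm (evalZero f) + coordX * u + coordY * v ∧
    evalZero u = d0 f (1, 0) ∧ evalZero v = d0 f (0, 1) := by
  obtain ⟨g, hg, rfl⟩ := exists_contDiff_toGerm f
  obtain ⟨u, hu, hgu, hu0⟩ := exists_hadamard_fst hg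
  -- The remainder `g(0, y)` is expanded in `y` by applying the first-variable lemma to `g ∘ swap`
  -- on the line `(y, 0)`.
  have hs : ContDiff ℝ ∞ fun p : Plane => g p.swap := hg.comp (contDiff_snd.prodMk contDiff_fst)
  obtain ⟨v, hv, hgv, hv0⟩ := exists_hadamard_fst hs
  have hv' : ContDiff ℝ ∞ fun p : Plane => v (p.2, 0) :=
    hv.comp (contDiff_snd.prodMk contDiff_const)
  refine ⟨(SmoothNear.of_contDiff hu).toGerm, (SmoothNear.of_contDiff hv').toGerm, ?_, hu0, ?_⟩
  · refine Subtype.ext (Germ.coe_eq.2 (Eventually.of_forall fun p => ?_))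
    have h1 := hgu p
    have h2 := hgv (p.2, 0)
    change g p = g 0 + p.1 * u p + p.2 * v (p.2, 0)
    simp only [Prod.swap_prod_mk, Prod.mk_zero_zero] at h2
    rw [h1, h2, Prod.swap_zero]
    ring
  · change v 0 = fderiv ℝ g 0 (0, 1)
    rw [hv0]
    have h1 : HasFDerivAt g (fderiv ℝ g 0) ((0 : Plane).swap) :=
      (hg.differentiable (by simp) 0).hasFDerivAt
    have h2 : HasFDerivAt (Prod.swap : Plane → Plane)
        ((ContinuousLinearMap.snd ℝ ℝ ℝ).prod (ContinuousLinearMap.fst ℝ ℝ ℝ)) 0 :=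
      hasFDerivAt_snd.prodMk hasFDerivAt_fst
    have h3 := (h1.comp (0 : Plane) h2).fderiv
    rw [show (fun p : Plane => g p.swap) = g ∘ Prod.swap from rfl, h3]
    simp

/-- Here `w` is `∂f/∂x`; its value at the origin decides whether it is a unit. -/
theorem lieDeriv_XL_eq (f : E) : ∃ w : E, evalZero w = d0 f (1, 0) ∧
    (⟨lieDeriv XL f, lieDeriv_smooth XL_smooth f⟩ : E) = -(coordX * w) := by
  obtain ⟨_, f, hf, rfl⟩ := f
  have hw : SmoothNear fun p => fderiv ℝ f p (1, 0) := by
    filter_upwards [hf.fderiv] with p hp using hp.clm_apply contDiffAt_const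
  refine ⟨hw.toGerm, rfl, Subtype.ext ?_⟩
  change lieDeriv XL (f : G ℝ) = _
  rw [XL_eq]
  refine Germ.coe_eq.2 (Eventually.of_forall fun p => ?_)
  change fderiv ℝ f p (-p.1, 0) = -(p.1 * fderiv ℝ f p (1, 0))
  rw [show ((-p.1, 0) : Plane) = (-p.1) • ((1, 0) : Plane) by simp, map_smul]
  simp

/-- The kernel of a nonzero functional `L` is a hyperplane, so it and the line through `w` span the
plane exactly when `L w ≠ 0`. -/
theorem regularTransversalCurve_iff (f : E) : RegularTransversalCurve f ↔
    evalZero f = 0 ∧ d0 f (1, 0) ≠ 0 ∧ d0 f (0, 1) ≠ 0 := by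
  have key : ∀ (L : Plane →L[ℝ] ℝ) (w : Plane), L ≠ 0 →
      (LinearMap.ker L.toLinearMap ⊔ Submodule.span ℝ {w} = ⊤ ↔ L w ≠ 0) := by
    intro L w hL
    constructor
    · intro h hw
      have h1 : Submodule.span ℝ {w} ≤ LinearMap.ker L.toLinearMap := by
        rw [Submodule.span_singleton_le_iff_mem]
        exact hw
      rw [sup_eq_left.2 h1, LinearMap.ker_eq_top] at h
      exact hL (ContinuousLinearMap.coe_injective h)
    · intro hw
      refine eq_top_iff.2 fun v _ => Submodule.mem_sup.2
        ⟨v - (L v / L w) • w, ?_, (L v / L w) • w,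
          Submodule.smul_mem _ _ (Submodule.mem_span_singleton_self w), sub_add_cancel _ _⟩
      simp [hw]
  constructor
  · rintro ⟨h, h0, h1, h2⟩
    exact ⟨h, (key _ _ h0).1 h1, (key _ _ h0).1 h2⟩
  · rintro ⟨h, h1, h2⟩
    have h0 : d0 f ≠ 0 := fun h => h1 (by simp [h])
    exact ⟨h, h0, (key _ _ h0).2 h1, (key _ _ h0).2 h2⟩

/-- Since `∂ₓf` is a unit, `x ∂ₓf` yields `x`; then `f - x u = y v` with `v` a unit yields `y`. By
Hadamard, `x` and `y` generate the maximal ideal. -/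
theorem tangentIdeal_eq_ker {f : E} (hf : RegularTransversalCurve f) :
    tangentIdeal f = RingHom.ker evalZero := by
  obtain ⟨h0, h1, h2⟩ := (regularTransversalCurve_iff f).1 hf
  obtain ⟨w, hw, hl⟩ := lieDeriv_XL_eq f
  obtain ⟨u, v, huv, hu, hv⟩ := exists_hadamard f
  have hx0 : evalZero coordX = 0 := rfl
  rw [tangentIdeal, hl]
  apply le_antisymm
  · rw [Ideal.span_le]
    rintro _ (rfl | rfl)
    · exact h0
    · simp [RingHom.mem_ker, hx0]
  · have hx : coordX ∈ Ideal.span {f, -(coordX * w)} := by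
      have h : -(coordX * w) ∈ Ideal.span {f, -(coordX * w)} := Ideal.subset_span (by simp)
      rw [neg_mem_iff] at h
      exact (Ideal.mul_unit_mem_iff_mem _ (isUnit_of_evalZero_ne (hw ▸ h1))).1 h
    have hy : coordY ∈ Ideal.span {f, -(coordX * w)} := by
      refine (Ideal.mul_unit_mem_iff_mem _ (isUnit_of_evalZero_ne (hv ▸ h2))).1 ?_
      have h3 : coordY * v = f - coordX * u := by
        rw [h0, map_zero] at huv
        linear_combination -huv
      rw [h3]
      exact sub_mem (Ideal.subset_span (by simp)) (Ideal.mul_mem_right _ _ hx)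
    intro g hg
    obtain ⟨a, b, hab, -, -⟩ := exists_hadamard g
    rw [RingHom.mem_ker] at hg
    rw [hg, map_zero, zero_add] at hab
    rw [hab]
    exact add_mem (Ideal.mul_mem_right _ _ hx) (Ideal.mul_mem_right _ _ hy)

theorem codim_of_mem {X : kerL} (hX : X ∈ transversalFields) : codim X = 1 := by
  have hs : Function.Surjective evalZero := fun c => ⟨constGerm c, rfl⟩
  rw [codim, tangentIdeal_eq_ker hX]
  rw [← Module.rank_self ℝ]
  exact (Ideal.quotientKerAlgEquivOfSurjective hs).toLinearEquiv.rank_eq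

/-! ### The conjugacy class of `(x + y) · X_L`. -/

/-- Cancellation of `x`: a restatement of the injectivity of `f ↦ f · X_L`. -/
theorem eventually_eq_of_mul_fst {f g : Plane → ℝ} (hf : SmoothNear f) (hg : SmoothNear g)
    (h : ∀ᶠ p in 𝓝 (0 : Plane), f p * p.1 = g p * p.1) : f =ᶠ[𝓝 0] g := by
  have h1 : (hf.toGerm : E) = hg.toGerm := by
    apply smul_XL_injective
    simp only [LinearMap.toSpanSingleton_apply, XL_eq]
    refine Germ.coe_eq.2 ?_
    filter_upwards [h] with p hp
    change f p • ((-p.1, 0) : Plane) = g p • ((-p.1, 0) : Plane)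
    ext <;> simp [hp]
  exact Germ.coe_eq.1 (congrArg Subtype.val h1)

theorem orbitallyConj_of_regularTransversalCurve {f : E} (hf : RegularTransversalCurve f) :
    OrbitallyConj aL (f • XL) (xPlusY • XL) := by
  obtain ⟨h0, h1, h2⟩ := (regularTransversalCurve_iff f).1 hf
  obtain ⟨g, hg, rfl⟩ := exists_contDiff_toGerm f
  replace h0 : g 0 = 0 := h0
  replace h1 : fderiv ℝ g 0 (1, 0) ≠ 0 := h1
  replace h2 : fderiv ℝ g 0 (0, 1) ≠ 0 := h2
  obtain ⟨u, hu, hgu, hu0⟩ := exists_hadamard_fst hg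
  let P : Plane →L[ℝ] Plane :=
    (ContinuousLinearMap.inr ℝ ℝ ℝ).comp (ContinuousLinearMap.snd ℝ ℝ ℝ)
  have hg' : ContDiff ℝ ∞ (fderiv ℝ g) := hg.fderiv_right (by simp)
  -- With `P (x, y) = (0, y)`, this is `(x u, g(0, y))`, and its components sum to `g`.
  let φ₀ : Plane → Plane := fun p => (g p - g (P p), g (P p))
  have hφs : ContDiff ℝ ∞ φ₀ :=
    (hg.sub (hg.comp P.contDiff)).prodMk (hg.comp P.contDiff)
  have hφ1 : ∀ p, (φ₀ p).1 = p.1 * u p := fun p => by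
    change g p - g (0, p.2) = _
    rw [hgu p]; ring
  have hφ' : ∀ p, fderiv ℝ φ₀ p =
      (fderiv ℝ g p - (fderiv ℝ g (P p)).comp P).prod ((fderiv ℝ g (P p)).comp P) := fun p => by
    have hd : ∀ q, HasFDerivAt g (fderiv ℝ g q) q := fun q =>
      (hg.differentiable (by simp) q).hasFDerivAt
    have hc := (hd (P p)).comp p P.hasFDerivAt
    exact (((hd p).sub hc).prodMk hc).fderiv
  have hP1 : P (1, 0) = 0 := by simp [P]
  have hP2 : P (0, 1) = (0, 1) := by simp [P]
  have ha : ∀ p, fderiv ℝ φ₀ p (1, 0) = (fderiv ℝ g p (1, 0), 0) := fun p => by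
    simp [hφ', hP1]
  have hd : ∀ p, (fderiv ℝ φ₀ p (0, 1)).2 = fderiv ℝ g (P p) (0, 1) := fun p => by
    simp [hφ', hP2]
  have hsx : SmoothNear fun p => fderiv ℝ g p (1, 0) :=
    .of_contDiff (hg'.clm_apply contDiff_const)
  have hsy : SmoothNear fun p => fderiv ℝ g (P p) (0, 1) :=
    .of_contDiff ((hg'.comp P.contDiff).clm_apply contDiff_const)
  have hP0 : P 0 = 0 := map_zero P
  have hφ0 : φ₀ 0 = 0 := by simp [φ₀, h0]
  obtain ⟨φ, hφ⟩ := exists_localDiffeo (.of_contDiff hφs) hφ0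
    (isInvertible_of_triangular (by simp [ha]) (by simpa [ha] using h1)
      (by rw [hd, hP0]; exact h2))
  have hu0' : u 0 ≠ 0 := hu0 ▸ h1
  have hsu : SmoothNear u := .of_contDiff hu
  have hk0 : u 0 * fderiv ℝ g (P 0) (0, 1) ≠ 0 := mul_ne_zero hu0' (by rwa [hP0])
  have hxe := hsx.self_of_nhds.continuousAt.eventually_ne h1
  have hye := hsy.self_of_nhds.continuousAt.eventually_ne
    (by rwa [hP0] : fderiv ℝ g (P 0) (0, 1) ≠ 0)
  have hue := hsu.self_of_nhds.continuousAt.eventually_ne hu0'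
  -- `φ^*(x dy) = x u ∂ᵧg(0, y) dy` forces `k = 1 / (u ∂ᵧg(0, y))`. The pulled-back field is `-(g x
  -- u / ∂ₓg) ∂/∂x`, which forces `h = ∂ₓg / u`.
  refine ⟨φ, ((hsu.mul hsy).inv hk0).toGerm, (hsx.mul (hsu.inv hu0')).toGerm,
    inv_ne_zero hk0, mul_ne_zero h1 (inv_ne_zero hu0'), ?_, ?_⟩
  · refine Germ.coe_eq.2 ?_
    filter_upwards [hue, hye] with p h3 h4
    change p.1 • ContinuousLinearMap.snd ℝ ℝ ℝ = (u p * fderiv ℝ g (P p) (0, 1))⁻¹ •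
      ((φ.toFun p).1 • ContinuousLinearMap.snd ℝ ℝ ℝ).comp (fderiv ℝ φ.toFun p)
    rw [hφ]
    ext
    · simp [ha]
    · simp [hd, hφ1]
      field_simp
  · rw [XL_eq]
    refine Germ.coe_eq.2 ?_
    filter_upwards [hue, hye, hxe] with p h3 h4 h5
    change g p • ((-p.1, 0) : Plane) = (fderiv ℝ g p (1, 0) * (u p)⁻¹) •
      (fderiv ℝ φ.toFun p).inverse
        (((φ.toFun p).1 + (φ.toFun p).2) • ((-(φ.toFun p).1, 0) : Plane))
    rw [hφ, Prod.smul_mk ((φ₀ p).1 + (φ₀ p).2), smul_zero, inverse_apply_of_triangular (by simp [ha])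
      (by simpa [ha] using h5) (by rw [hd]; exact h4), ha]
    have h6 : (φ₀ p).1 + (φ₀ p).2 = g p := by simp [φ₀]
    rw [h6, hφ1]
    ext
    · simp
      field_simp
    · simp

theorem regularTransversalCurve_of_orbitallyConj {f : E}
    (hc : OrbitallyConj aL (f • XL) (xPlusY • XL)) : RegularTransversalCurve f := by
  obtain ⟨φ, ⟨_, K, hK, rfl⟩, ⟨_, H, hH, rfl⟩, hk0, hh0, hA, hB⟩ := hc
  obtain ⟨_, F, hF, rfl⟩ := f
  replace hh0 : H 0 ≠ 0 := hh0
  have hA' : ∀ᶠ p in 𝓝 (0 : Plane), p.1 • ContinuousLinearMap.snd ℝ ℝ ℝ = K p •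
      ((φ.toFun p).1 • ContinuousLinearMap.snd ℝ ℝ ℝ).comp (fderiv ℝ φ.toFun p) :=
    Germ.coe_eq.1 hA
  have hB' : ∀ᶠ p in 𝓝 (0 : Plane), F p • ((-p.1, 0) : Plane) = H p •
      (fderiv ℝ φ.toFun p).inverse
        (((φ.toFun p).1 + (φ.toFun p).2) • ((-(φ.toFun p).1, 0) : Plane)) := by
    rw [XL_eq] at hB
    exact Germ.coe_eq.1 hB
  have hs := φ.smooth
  have hm := φ.map_zero
  generalize φ.toFun = ψ at hA' hB' hs hm
  have hs1 : SmoothNear fun p => (ψ p).1 := by filter_upwards [hs] with p hp using hp.fst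
  have hs2 : SmoothNear fun p => (ψ p).2 := by filter_upwards [hs] with p hp using hp.snd
  have hs' : ∀ v, SmoothNear fun p => fderiv ℝ ψ p v := fun v => by
    filter_upwards [hs.fderiv] with p hp using hp.clm_apply contDiffAt_const
  have hsa : SmoothNear fun p => (fderiv ℝ ψ p (1, 0)).1 := by
    filter_upwards [hs' (1, 0)] with p hp using hp.fst
  have hsb : SmoothNear fun p => (fderiv ℝ ψ p (1, 0)).2 := by
    filter_upwards [hs' (1, 0)] with p hp using hp.snd
  have hsd : SmoothNear fun p => (fderiv ℝ ψ p (0, 1)).2 := by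
    filter_upwards [hs' (0, 1)] with p hp using hp.snd
  have hA1 : ∀ᶠ p in 𝓝 (0 : Plane), K p * ((ψ p).1 * (fderiv ℝ ψ p (1, 0)).2) = 0 := by
    filter_upwards [hA'] with p hp
    simpa using (congrArg (fun L : Plane →L[ℝ] ℝ => L (1, 0)) hp).symm
  have hA2 : ∀ᶠ p in 𝓝 (0 : Plane), p.1 = (ψ p).1 * (K p * (fderiv ℝ ψ p (0, 1)).2) := by
    filter_upwards [hA'] with p hp
    have : p.1 = K p * ((ψ p).1 * (fderiv ℝ ψ p (0, 1)).2) := by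
      simpa using congrArg (fun L : Plane →L[ℝ] ℝ => L (0, 1)) hp
    rw [this]; ring
  -- The `dx` and `dy` components of the symmetry equation give `x ∂ₓψ₂ = ∂ᵧψ₂ · (K ψ₁ ∂ₓψ₂) = 0`;
  -- then `x` cancels.
  have hb : (fun p => (fderiv ℝ ψ p (1, 0)).2) =ᶠ[𝓝 0] fun _ => 0 := by
    refine eventually_eq_of_mul_fst hsb (.of_contDiff contDiff_const) ?_
    filter_upwards [hA1, hA2] with p h1 h2
    rw [h2]
    linear_combination (fderiv ℝ ψ p (0, 1)).2 * h1
  have hder : ∀ {u : Plane → ℝ}, SmoothNear u → HasFDerivAt u (fderiv ℝ u 0) 0 := fun hu =>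
    (hu.self_of_nhds.differentiableAt (by simp)).hasFDerivAt
  have hψ : HasFDerivAt ψ (fderiv ℝ ψ 0) 0 :=
    (hs.self_of_nhds.differentiableAt (by simp)).hasFDerivAt
  have hw := hK.mul hsd
  have hwa := hw.mul hsa
  -- Differentiating `x = ψ₁ · K ∂ᵧψ₂` at `0`, where `ψ₁` vanishes, gives `∂ₓψ₁ · K ∂ᵧψ₂ = 1` and
  -- `∂ᵧψ₁ = 0` there.
  have hfst : ContinuousLinearMap.fst ℝ ℝ ℝ = _ :=
    (hasFDerivAt_fst (𝕜 := ℝ) (p := (0 : Plane))).unique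
      ((hψ.fst.mul (hder hw)).congr_of_eventuallyEq hA2)
  have e1 := congrArg (fun L : Plane →L[ℝ] ℝ => L (1, 0)) hfst
  have e2 := congrArg (fun L : Plane →L[ℝ] ℝ => L (0, 1)) hfst
  simp [hm] at e1 e2
  have ha0 : (fderiv ℝ ψ 0 (1, 0)).1 ≠ 0 := fun h => by simp [h] at e1
  have hK0 : K 0 ≠ 0 := fun h => by simp [h] at e1
  have hd0 : (fderiv ℝ ψ 0 (0, 1)).2 ≠ 0 := fun h => by simp [h] at e1
  have hc0 : (fderiv ℝ ψ 0 (0, 1)).1 = 0 := by simpa [hK0, hd0] using e2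
  have hb0 : (fderiv ℝ ψ 0 (1, 0)).2 = 0 := hb.self_of_nhds
  have hFH : (fun p => F p * (K p * (fderiv ℝ ψ p (0, 1)).2 * (fderiv ℝ ψ p (1, 0)).1)) =ᶠ[𝓝 0]
      fun p => H p * ((ψ p).1 + (ψ p).2) := by
    have hg : SmoothNear fun p => (ψ p).1 + (ψ p).2 := by
      filter_upwards [hs1, hs2] with p h1 h2 using h1.add h2
    refine eventually_eq_of_mul_fst (hF.mul hwa) (hH.mul hg) ?_
    -- The diagonal entries stay nonzero nearby, so `inverse` is a true inverse there and not its
    -- default value `0`.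
    filter_upwards [hB', hA2, hb, hsa.self_of_nhds.continuousAt.eventually_ne ha0,
      hsd.self_of_nhds.continuousAt.eventually_ne hd0] with p h1 h2 h3 h4 h5
    rw [Prod.smul_mk ((ψ p).1 + (ψ p).2), smul_zero, inverse_apply_of_triangular h3 h4 h5] at h1
    have h6 := congrArg Prod.fst h1
    simp only [Prod.smul_fst, smul_eq_mul] at h6
    have h7 : F p * p.1 * (fderiv ℝ ψ p (1, 0)).1 =
        H p * ((ψ p).1 + (ψ p).2) * (ψ p).1 := by
      field_simp at h6
      linear_combination -h6
    -- Multiplying by `K ∂ᵧψ₂` turns the factor `ψ₁` on the right into `x`, ready to be cancelled.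
    linear_combination (K p * (fderiv ℝ ψ p (0, 1)).2) * h7 - H p * ((ψ p).1 + (ψ p).2) * h2
  have hne : K 0 * (fderiv ℝ ψ 0 (0, 1)).2 * (fderiv ℝ ψ 0 (1, 0)).1 ≠ 0 := by
    simp [hK0, hd0, ha0]
  have hF0 : F 0 = 0 := by
    have := hFH.self_of_nhds
    simpa [hm, hne, hK0, ha0, hd0] using this
  -- At `0` both `F` and `ψ` vanish, so only `dF` and `dψ` survive: up to nonzero factors, `∂ₓF` is
  -- `∂ₓψ₁` and `∂ᵧF` is `∂ᵧψ₂`.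
  have hdF := ((hder hF).mul (hder hwa)).unique
    (((hder hH).mul (hψ.fst.add hψ.snd)).congr_of_eventuallyEq hFH)
  have e3 := congrArg (fun L : Plane →L[ℝ] ℝ => L (1, 0)) hdF
  have e4 := congrArg (fun L : Plane →L[ℝ] ℝ => L (0, 1)) hdF
  simp [hm, hF0, hb0, hc0] at e3 e4
  refine (regularTransversalCurve_iff _).2 ⟨hF0, fun h => ?_, fun h => ?_⟩
  · replace h : fderiv ℝ F 0 (1, 0) = 0 := h
    simp [h, hh0, ha0] at e3
  · replace h : fderiv ℝ F 0 (0, 1) = 0 := h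
    simp [h, hh0, hd0] at e4

/-! ### The class as a set, and transversality of the family. -/

theorem coe_eq_smul_XL (X : kerL) : (X : G Plane) = toField.symm X • XL := by
  rw [← toField_coe, LinearEquiv.apply_symm_apply]

theorem transversalFields_eq_conjClass : transversalFields = conjClass (toField xPlusY) := by
  ext X
  change RegularTransversalCurve (toField.symm X) ↔ OrbitallyConj aL X (toField xPlusY : G Plane)
  rw [coe_eq_smul_XL X, toField_coe]
  exact ⟨orbitallyConj_of_regularTransversalCurve, regularTransversalCurve_of_orbitallyConj⟩

theorem toField_xPlusY_mem : toField xPlusY ∈ transversalFields := by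
  change RegularTransversalCurve (toField.symm (toField xPlusY))
  rw [LinearEquiv.symm_apply_apply, regularTransversalCurve_iff]
  have h : d0 xPlusY = ContinuousLinearMap.fst ℝ ℝ ℝ + ContinuousLinearMap.snd ℝ ℝ ℝ :=
    (hasFDerivAt_fst.add hasFDerivAt_snd).fderiv
  refine ⟨add_zero (0 : ℝ), ?_, ?_⟩ <;> simp [h]

/-- The tangent space corresponds to the maximal ideal, so `g` splits as `(g - g(0)) + g(0) · 1`. -/
theorem tangentSpace_sup_span {X : kerL} (hX : X ∈ transversalFields) :
    tangentSpace X ⊔ Submodule.span ℝ {toField 1} = ⊤ := by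
  refine eq_top_iff.2 fun Z _ => ?_
  obtain ⟨g, rfl⟩ := toField.surjective Z
  have hg : g = (g - constGerm (evalZero g)) + constGerm (evalZero g) * 1 := by ring
  rw [hg, map_add]
  refine Submodule.add_mem_sup ?_ ?_
  · rw [tangentSpace, tangentIdeal_eq_ker hX]
    refine ⟨_, ?_, rfl⟩
    change evalZero (g - algebraMap ℝ E (evalZero g)) = 0
    rw [map_sub, AlgHom.commutes]
    exact sub_self _
  · refine Submodule.mem_span_singleton.2 ⟨evalZero g, ?_⟩
    rw [← smul_eq_mul, map_smul]
    apply Subtype.ext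
    rfl

theorem family_eq (c : ℝ) : (family c : G Plane) = toField (constGerm c + xPlusY) := by
  rw [toField_coe, XL_eq]
  refine Germ.coe_eq.2 (Eventually.of_forall fun p => ?_)
  change (c + p.1 + p.2) • ((-p.1, 0) : Plane) = (c + (p.1 + p.2)) • ((-p.1, 0) : Plane)
  rw [add_assoc]

theorem family_intersectsTransversely :
    IntersectsTransversely family 0 (toField xPlusY) := by
  refine ⟨Eventually.of_forall fun q => ?_, fun c => ?_, toField xPlusY, toField 1, ?_, ?_,
    transversalFields_eq_conjClass ▸ toField_xPlusY_mem,
    tangentSpace_sup_span toField_xPlusY_mem⟩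
  · unfold family
    fun_prop
  · rw [family_eq]
    exact Subtype.property _
  · rw [family_eq, map_zero, zero_add]
  · rw [toField_coe, one_smul, XL_eq]
    refine Germ.coe_eq.2 (Eventually.of_forall fun p => ?_)
    have h : HasDerivAt (fun c => family c p) ((1 : ℝ) • ((-p.1, 0) : Plane)) 0 :=
      (((hasDerivAt_id (0 : ℝ)).add_const p.1).add_const p.2).smul_const _
    change ((-p.1, 0) : Plane) = deriv (fun c => family c p) 0
    rw [h.deriv, one_smul]

end LiouvilleKernel

open LiouvilleKernel in
theorem mainTheorem6 :
    HasCodimension transversalFields 1 ∧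
    (∀ X ∈ transversalFields, OrbitallyConj aL (X : G Plane) (xPlusY • XL)) ∧
    transversalFields = conjClass (toField xPlusY) ∧
    IntersectsTransversely family 0 (toField xPlusY) := by
  refine ⟨⟨⟨_, transversalFields_eq_conjClass⟩, fun X hX => ?_⟩, fun X hX => ?_,
    transversalFields_eq_conjClass, family_intersectsTransversely⟩
  · rw [codim_of_mem hX, Nat.cast_one]
  · rw [transversalFields_eq_conjClass] at hX
    exact hX
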